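/- Let $\mathcal F_n$ be the free unital semigroup on $n$ generators $z_1,z_2,\dots$, where $n$ is a positive integer or $n=\infty$ (countably many generators), and let $\mathcal H_n=\ell^2(\mathcal F_n)$ with its standard orthonormal basis $\{\xi_v\}_{v\in\mathcal F_n}$. For a word $w$ let $L_w$ be the isometry of $\mathcal H_n$ with $L_w\xi_v=\xi_{wv}$ for all $v$, and put $L_i=L_{z_i}$. Let $\mathfrak L_n$ be the unital algebra generated by the $L_i$, closed in the weak operator topology. Let $f(z)=\sum_{k\ge 0}\frac{z^k}{k+1}$ for $|z|<1$. A proper factorization of $T$ in $\mathfrak L_n$ is a factorization $T=BC$ with $B,C\in\mathfrak L_n$ and with neither $B$ nor $C$ invertible in $\mathcal B(\mathcal H_n)$ (hence neither invertible in $\mathfrak L_n$). If $X$ is a contraction and $h(z)=\sum_k c_kz^k$ is in $H^\infty$ (bounded and analytic on the open unit disc), then $h(X)$ denotes the strong operator limit $\lim_{r\to1^-}\sum_{k}c_kr^kX^k$, when this limit exists. **Theorem.** 1. The function $f$ has no zero in the open unit disc, and $g=1/f$ belongs to $H^\infty$. 2. Suppose that $L$ and $X$ are isometries in $\mathfrak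 L_n$ such that the range of $X$ is contained in $\mathcal H_n\ominus L\mathcal H_n$. Then the series $A=\sum_{k\ge0}\frac1{k+1}X^kL$ converges unconditionally in operator norm to an operator in $\mathfrak L_n$, the operator $g(X)$ exists and belongs to $\mathfrak L_n$, and $L=g(X)A$ is a proper factorization of $L$ in $\mathfrak L_n$; that is, neither $g(X)$ nor $A$ is invertible. 3. Consequently, for $n\ge 2$ every generator $L_i$ has a proper factorization in $\mathfrak L_n$. -/

import Mathlib

open Filter Topology Metric

noncomputable section

namespace NCToeplitz

/-- The Hilbert space `ℓ²(F)` of the free unital semigroup `F` on a set `ι` of generators.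
For `ι` with `n` elements this is `ℋ_n`; a countably infinite `ι` is the case `n = ∞`. -/
abbrev Fock (ι : Type*) : Type _ := lp (fun _ : FreeMonoid ι => ℂ) 2

variable {ι : Type*}

open Classical in
/-- The standard orthonormal basis vector `ξ_v` of the Hilbert space, for a word `v`. -/
def xi (v : FreeMonoid ι) : Fock ι := lp.single 2 v (1 : ℂ)

theorem orthonormal_xi : Orthonormal ℂ (xi : FreeMonoid ι → Fock ι) := by
  classical
  rw [orthonormal_iff_ite]
  intro v w
  rw [xi, xi, lp.inner_single_left, lp.single_apply]
  by_cases h : v = w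
  · subst h; simp
  · simp [h]

theorem orthonormal_xi_mul (w : FreeMonoid ι) :
    Orthonormal ℂ (fun v : FreeMonoid ι => xi (w * v)) :=
  orthonormal_xi.comp (fun v => w * v) (mul_right_injective w)

/-- The left regular representation: `lam w` is the isometry `L_w` on `ℓ²(F)` with
`L_w ξ_v = ξ_{wv}` for all words `v`. -/
def lam (w : FreeMonoid ι) : Fock ι →L[ℂ] Fock ι :=
  (orthonormal_xi_mul w).orthogonalFamily.linearIsometry.toContinuousLinearMap

theorem lam_xi (w v : FreeMonoid ι) : lam w (xi v) = xi (w * v) := by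
  classical
  have h := (orthonormal_xi_mul w).orthogonalFamily.linearIsometry_apply_single
    (i := v) (1 : ℂ)
  simp only [LinearIsometry.toSpanSingleton_apply, one_smul] at h
  rw [← h, lam, xi]
  simp only [LinearIsometry.coe_toContinuousLinearMap]

variable (ι) in
/-- The non-commutative analytic Toeplitz algebra: the unital algebra generated by the isometries
`L_i`, closed in the weak operator topology. -/
def toeplitzAlgebra : Subalgebra ℂ (Fock ι →L[ℂ] Fock ι) :=
  let e : (Fock ι →L[ℂ] Fock ι) ≃ₐ[ℂ] (Fock ι →WOT[ℂ] Fock ι) :=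
    (ContinuousLinearMapWOT.algEquiv ℂ).symm
  (((Algebra.adjoin ℂ (Set.range fun i : ι => lam (FreeMonoid.of i))).map
    e.toAlgHom).topologicalClosure).comap e.toAlgHom

theorem mem_toeplitzAlgebra_iff (T : Fock ι →L[ℂ] Fock ι) :
    T ∈ toeplitzAlgebra ι ↔
      ContinuousLinearMapWOT.ofCLM T ∈ closure (ContinuousLinearMapWOT.ofCLM ''
        (Algebra.adjoin ℂ (Set.range fun i : ι => lam (FreeMonoid.of i)) :
          Set (Fock ι →L[ℂ] Fock ι))) :=
  Iff.rfl

/-- `T = B C` is a proper factorization in the Toeplitz algebra: both factors are in the algebra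
and neither is invertible. Non-invertibility is required in the algebra of all bounded operators,
which in particular gives non-invertibility in the Toeplitz algebra. -/
structure IsProperFactorization (T B C : Fock ι →L[ℂ] Fock ι) : Prop where
  left_mem : B ∈ toeplitzAlgebra ι
  right_mem : C ∈ toeplitzAlgebra ι
  eq_mul : T = B * C
  left_not_isUnit : ¬ IsUnit B
  right_not_isUnit : ¬ IsUnit C

/-- `h ∈ H^∞`: `h` is analytic and bounded on the open unit disc. -/
def IsHInfty (h : ℂ → ℂ) : Prop :=
  DifferentiableOn ℂ h (ball 0 1) ∧ ∃ C : ℝ, ∀ z ∈ ball (0 : ℂ) 1, ‖h z‖ ≤ C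

/-- The `k`-th Taylor coefficient of `h` at the origin. -/
def taylorCoeff (h : ℂ → ℂ) (k : ℕ) : ℂ := iteratedDeriv k h 0 / (k.factorial : ℂ)

/-- `S = h(T)` in the Sz.-Nagy–Foias `H^∞` functional calculus of a contraction `T`: with
`h(z) = ∑ c_k z^k`, the operators `h_r(T) = ∑ c_k r^k T^k` converge strongly to `S` as
`r` increases to `1`. -/
def IsHInftyCalculus {E : Type*} [NormedAddCommGroup E] [InnerProductSpace ℂ E]
    (T : E →L[ℂ] E) (h : ℂ → ℂ) (S : E →L[ℂ] E) : Prop :=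
  ∀ x : E, Tendsto
    (fun r : ℝ => (∑' k : ℕ, (taylorCoeff h k * (r : ℂ) ^ k) • T ^ k : E →L[ℂ] E) x)
    (𝓝[<] 1) (𝓝 (S x))

/-- The function `f(z) = ∑_{k ≥ 0} z^k / (k + 1)` on the open unit disc. -/
def logSeries (z : ℂ) : ℂ := ∑' k : ℕ, z ^ k / ((k : ℂ) + 1)

end NCToeplitz

end

/-! Let `c_k` be the Taylor coefficients of `g = 1/f`. The sequence `1/(k+1)` is logarithmically
convex, so by Kaluza's argument `c_k ≤ 0` for `k ≥ 1`. The convolution identity then gives `∑ |c_k|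
≤ 2`, so `g` is bounded, and `g(X) = ∑ c_k X^k` converges absolutely for every contraction `X`.

Since `X` maps into the complement of the range of `L`, the isometries `X^k L` have pairwise
orthogonal ranges. Hence `∑ b_k X^k L` has norm at most the `ℓ²` norm of `b`, and `A` exists
although `∑ 1/(k+1)` diverges. For `r < 1`, `g(rX) f(rX) L = L`; letting `r → 1` in norm gives `g(X)
A = L`.

`A` is not onto: its range meets that of `L` only in `0`. `g(X)` is not invertible: each `r` in `[0,
1)` is an eigenvalue of `X*`, so `g(r) = 1/f(r)` is an eigenvalue of `g(X)*`, and `f(r)` is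
unbounded by divergence of the harmonic series. -/

noncomputable section

namespace NCToeplitz

/-! ### Coefficients of the reciprocal series: signs and absolute summability -/

section Coefficients

/-- The power series `∑ X ^ k / (k + 1)` with real coefficients. -/
def logPowerSeries : PowerSeries ℝ := PowerSeries.mk fun k : ℕ => 1 / ((k : ℝ) + 1)

/-- The Taylor coefficients of the reciprocal of `∑ z ^ k / (k + 1)`. -/
def recipCoeff (k : ℕ) : ℝ := PowerSeries.coeff k logPowerSeries⁻¹

theorem sum_antidiagonal_recipCoeff (n : ℕ) :
    ∑ p ∈ Finset.HasAntidiagonal.antidiagonal n, recipCoeff p.1 * (1 / ((p.2 : ℝ) + 1)) = if n = 0 then 1 else 0 := by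
  have h : logPowerSeries⁻¹ * logPowerSeries = 1 :=
    PowerSeries.inv_mul_cancel _ (by simp [logPowerSeries])
  have h2 := congrArg (PowerSeries.coeff n) h
  rw [PowerSeries.coeff_mul, PowerSeries.coeff_one] at h2
  simpa [recipCoeff, logPowerSeries] using h2

theorem recipCoeff_zero : recipCoeff 0 = 1 := by
  simpa using sum_antidiagonal_recipCoeff 0

theorem sum_range_recipCoeff (n : ℕ) :
    ∑ j ∈ Finset.range (n + 1), recipCoeff j * (1 / (((n - j : ℕ) : ℝ) + 1)) =
      if n = 0 then 1 else 0 := by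
  rw [← sum_antidiagonal_recipCoeff n,
    Finset.Nat.sum_antidiagonal_eq_sum_range_succ
      (fun i j => recipCoeff i * (1 / ((j : ℝ) + 1)))]

/-- Kaluza's sign theorem for the logarithmically convex sequence `1 / (k + 1)`. -/
theorem recipCoeff_succ_nonpos (n : ℕ) : recipCoeff (n + 1) ≤ 0 := by
  induction n using Nat.strong_induction_on with
  | _ n ih =>
    have h1 := sum_range_recipCoeff (n + 1)
    rw [Finset.sum_range_succ, if_neg n.succ_ne_zero] at h1
    simp only [Nat.sub_self, Nat.cast_zero, zero_add, div_one, mul_one] at h1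
    -- Scaling the identity at `n` by `(n+1)/(n+2)` makes its `j = 0` term equal to that of the
    -- identity at `n + 1`. The other terms compare by `(m+1)/(m+2) ≤ (n+1)/(n+2)` for `m ≤ n`,
    -- reversed by the nonpositive coefficients. The `1/2` at `n = 0` is harmless slack: that case
    -- is read off from `h1`.
    have h2 : ((n : ℝ) + 1) / (n + 2) *
        ∑ j ∈ Finset.range (n + 1), recipCoeff j * (1 / (((n - j : ℕ) : ℝ) + 1)) ≤
        ∑ j ∈ Finset.range (n + 1), recipCoeff j * (1 / (((n + 1 - j : ℕ) : ℝ) + 1)) +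
          (if n = 0 then 1 / 2 else 0) := by
      rw [Finset.mul_sum, Finset.sum_range_succ', Finset.sum_range_succ']
      have h0 : ((n : ℝ) + 1) / (n + 2) * (recipCoeff 0 * (1 / (((n - 0 : ℕ) : ℝ) + 1))) =
          recipCoeff 0 * (1 / (((n + 1 - 0 : ℕ) : ℝ) + 1)) := by
        rw [recipCoeff_zero, Nat.sub_zero, Nat.sub_zero]
        push_cast
        field_simp
        ring
      rw [h0]
      have h3 : ∑ j ∈ Finset.range n, ((n : ℝ) + 1) / (n + 2) *
            (recipCoeff (j + 1) * (1 / (((n - (j + 1) : ℕ) : ℝ) + 1))) ≤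
          ∑ j ∈ Finset.range n, recipCoeff (j + 1) *
            (1 / (((n + 1 - (j + 1) : ℕ) : ℝ) + 1)) := by
        refine Finset.sum_le_sum fun j hj => ?_
        have hj' : j + 1 ≤ n := Finset.mem_range.1 hj
        obtain ⟨m, rfl⟩ := Nat.exists_eq_add_of_le hj'
        have hc := ih j (by omega)
        have e1 : j + 1 + m - (j + 1) = m := by omega
        have e2 : j + 1 + m + 1 - (j + 1) = m + 1 := by omega
        rw [e1, e2, mul_left_comm]
        refine mul_le_mul_of_nonpos_left ?_ hc
        push_cast
        rw [div_mul_div_comm, div_le_div_iff₀ (by positivity) (by positivity)]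
        nlinarith [(Nat.cast_nonneg j : (0 : ℝ) ≤ j), (Nat.cast_nonneg m : (0 : ℝ) ≤ m)]
      have : (0 : ℝ) ≤ if n = 0 then 1 / 2 else 0 := by split_ifs <;> norm_num
      linarith
    rw [sum_range_recipCoeff n] at h2
    split_ifs at h2 with hn
    · subst hn
      norm_num at h2 h1
      linarith [recipCoeff_zero]
    · linarith

/-- In the convolution identity at `n ≥ 1` the zeroth term is `1/(n+1)`. The remaining terms have
one sign and weights at least `1/(n+1)`, and they cancel it. -/
theorem sum_abs_recipCoeff_succ_le (n : ℕ) :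
    ∑ j ∈ Finset.range n, |recipCoeff (j + 1)| ≤ 1 := by
  rcases Nat.eq_zero_or_pos n with rfl | hn
  · simp
  have h1 := sum_range_recipCoeff n
  rw [Finset.sum_range_succ', recipCoeff_zero, if_neg hn.ne'] at h1
  have h2 : (∑ j ∈ Finset.range n, |recipCoeff (j + 1)|) * (1 / ((n : ℝ) + 1)) ≤
      1 / ((n : ℝ) + 1) := by
    have h3 : (∑ j ∈ Finset.range n, |recipCoeff (j + 1)|) * (1 / ((n : ℝ) + 1)) ≤
        -∑ j ∈ Finset.range n, recipCoeff (j + 1) * (1 / (((n - (j + 1) : ℕ) : ℝ) + 1)) := by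
      rw [Finset.sum_mul, ← Finset.sum_neg_distrib]
      refine Finset.sum_le_sum fun j _ => ?_
      rw [abs_of_nonpos (recipCoeff_succ_nonpos j), ← neg_mul]
      refine mul_le_mul_of_nonneg_left ?_ (neg_nonneg.2 (recipCoeff_succ_nonpos j))
      have : ((n - (j + 1) : ℕ) : ℝ) ≤ n := by exact_mod_cast Nat.sub_le _ _
      gcongr
    simp only [Nat.sub_zero, one_mul] at h1
    linarith
  have h4 : (0 : ℝ) < 1 / ((n : ℝ) + 1) := by positivity
  nlinarith

theorem summable_abs_recipCoeff : Summable fun k => |recipCoeff k| :=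
  (summable_nat_add_iff 1).1
    (summable_of_sum_range_le (fun _ => abs_nonneg _) sum_abs_recipCoeff_succ_le)

variable {𝔸 : Type*} [NormedRing 𝔸] [NormOneClass 𝔸] [NormedAlgebra ℂ 𝔸]

theorem norm_recipCoeff_smul_pow_le (x : 𝔸) (hx : ‖x‖ ≤ 1) (k : ℕ) :
    ‖(recipCoeff k : ℂ) • x ^ k‖ ≤ |recipCoeff k| := by
  rw [norm_smul, Complex.norm_real, Real.norm_eq_abs]
  exact mul_le_of_le_one_right (abs_nonneg _)
    ((norm_pow_le x k).trans (pow_le_one₀ (norm_nonneg _) hx))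

theorem summable_norm_recipCoeff_smul_pow (x : 𝔸) (hx : ‖x‖ ≤ 1) :
    Summable fun k => ‖(recipCoeff k : ℂ) • x ^ k‖ :=
  .of_nonneg_of_le (fun _ => norm_nonneg _) (norm_recipCoeff_smul_pow_le x hx)
    summable_abs_recipCoeff

theorem norm_one_div_natCast_add_one_le (k : ℕ) : ‖(1 / ((k : ℂ) + 1) : ℂ)‖ ≤ 1 := by
  rw [norm_div, norm_one, ← Nat.cast_add_one, Complex.norm_natCast]
  exact div_le_one_of_le₀ (by push_cast; linarith [(Nat.cast_nonneg k : (0 : ℝ) ≤ k)])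
    (by positivity)

theorem summable_norm_logSeries_smul_pow (x : 𝔸) (hx : ‖x‖ < 1) :
    Summable fun k : ℕ => ‖(1 / ((k : ℂ) + 1)) • x ^ k‖ := by
  refine .of_nonneg_of_le (fun _ => norm_nonneg _) (fun k => ?_)
    (summable_geometric_of_lt_one (norm_nonneg x) hx)
  rw [norm_smul]
  exact (mul_le_of_le_one_left (norm_nonneg _) (norm_one_div_natCast_add_one_le k)).trans
    (norm_pow_le x k)

/-- A Cauchy product, stated in a Banach algebra so as to serve both for scalars `z` and for
operators `rX`. -/
theorem tsum_recipCoeff_mul_tsum_logSeries [CompleteSpace 𝔸] (x : 𝔸) (hx : ‖x‖ < 1) :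
    (∑' k, (recipCoeff k : ℂ) • x ^ k) * (∑' k : ℕ, (1 / ((k : ℂ) + 1)) • x ^ k) = 1 := by
  rw [tsum_mul_tsum_eq_tsum_sum_antidiagonal_of_summable_norm
    (summable_norm_recipCoeff_smul_pow x hx.le) (summable_norm_logSeries_smul_pow x hx)]
  have h (n : ℕ) : ∑ p ∈ Finset.HasAntidiagonal.antidiagonal n,
      ((recipCoeff p.1 : ℂ) • x ^ p.1) * ((1 / ((p.2 : ℂ) + 1)) • x ^ p.2) =
      if n = 0 then 1 else 0 := by
    have h1 : ∑ p ∈ Finset.HasAntidiagonal.antidiagonal n,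
        ((recipCoeff p.1 : ℂ) • x ^ p.1) * ((1 / ((p.2 : ℂ) + 1)) • x ^ p.2) =
        (∑ p ∈ Finset.HasAntidiagonal.antidiagonal n, (recipCoeff p.1 : ℂ) * (1 / ((p.2 : ℂ) + 1))) • x ^ n := by
      rw [Finset.sum_smul]
      refine Finset.sum_congr rfl fun p hp => ?_
      rw [smul_mul_smul_comm, ← pow_add, Finset.HasAntidiagonal.mem_antidiagonal.1 hp]
    have h2 := congrArg (fun t : ℝ => (t : ℂ)) (sum_antidiagonal_recipCoeff n)
    push_cast at h2
    rw [h1, h2]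
    split_ifs with hn <;> simp [hn]
  simp only [h, tsum_ite_eq]

end Coefficients

/-! ### The function `1/f` on the disc and the growth of `f` -/

section Reciprocal

theorem logSeries_eq_tsum_smul (z : ℂ) :
    logSeries z = ∑' k : ℕ, (1 / ((k : ℂ) + 1)) • z ^ k := by
  simp only [logSeries, smul_eq_mul, one_div_mul_eq_div]

theorem tsum_recipCoeff_mul_logSeries {z : ℂ} (hz : z ∈ ball (0 : ℂ) 1) :
    (∑' k, (recipCoeff k : ℂ) • z ^ k) * logSeries z = 1 := by
  rw [logSeries_eq_tsum_smul]
  exact tsum_recipCoeff_mul_tsum_logSeries z (by simpa using hz)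

theorem logSeries_ne_zero {z : ℂ} (hz : z ∈ ball (0 : ℂ) 1) : logSeries z ≠ 0 :=
  right_ne_zero_of_mul_eq_one (tsum_recipCoeff_mul_logSeries hz)

theorem one_div_logSeries {z : ℂ} (hz : z ∈ ball (0 : ℂ) 1) :
    1 / logSeries z = ∑' k, (recipCoeff k : ℂ) • z ^ k :=
  (eq_div_of_mul_eq (logSeries_ne_zero hz) (tsum_recipCoeff_mul_logSeries hz)).symm

theorem hasFPowerSeriesOnBall_one_div_logSeries :
    HasFPowerSeriesOnBall (fun z => 1 / logSeries z)
      (FormalMultilinearSeries.ofScalars ℂ fun k => (recipCoeff k : ℂ)) 0 1 where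
  r_le := by
    refine ENNReal.le_of_forall_nnreal_lt fun r hr => ?_
    refine FormalMultilinearSeries.le_radius_of_summable_norm _ ?_
    refine .of_nonneg_of_le (fun _ => by positivity) (fun k => ?_) summable_abs_recipCoeff
    have hr1 : (r : ℝ) ≤ 1 := by exact_mod_cast hr.le
    rw [FormalMultilinearSeries.ofScalars_norm, Complex.norm_real, Real.norm_eq_abs]
    exact mul_le_of_le_one_right (abs_nonneg _) (pow_le_one₀ r.2 hr1)
  r_pos := one_pos
  hasSum := by
    intro y hy
    have hy' : y ∈ ball (0 : ℂ) 1 := by simpa [← Metric.eball_ofReal] using hy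
    have hs := (summable_norm_recipCoeff_smul_pow y
      (by simpa using (mem_ball_zero_iff.1 hy').le)).of_norm.hasSum
    rw [zero_add, one_div_logSeries hy']
    simpa [FormalMultilinearSeries.ofScalars_apply_eq, mul_comm] using hs

theorem isHInfty_one_div_logSeries : IsHInfty fun z => 1 / logSeries z := by
  refine ⟨?_, ∑' k, |recipCoeff k|, fun z hz => ?_⟩
  · have h := hasFPowerSeriesOnBall_one_div_logSeries.differentiableOn
    simpa [← Metric.eball_ofReal] using h
  · have hz1 : ‖z‖ ≤ 1 := (mem_ball_zero_iff.1 hz).le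
    simp only [one_div_logSeries hz]
    exact tsum_of_norm_bounded summable_abs_recipCoeff.hasSum
      (norm_recipCoeff_smul_pow_le z hz1)

theorem taylorCoeff_one_div_logSeries (k : ℕ) :
    taylorCoeff (fun z => 1 / logSeries z) k = recipCoeff k := by
  have h := hasFPowerSeriesOnBall_one_div_logSeries.hasFPowerSeriesAt
  have h2 := h.eq_formalMultilinearSeries h.analyticAt.hasFPowerSeriesAt
  have h3 := congrArg (fun p => FormalMultilinearSeries.coeff p k) h2
  simpa [FormalMultilinearSeries.coeff_ofScalars, taylorCoeff] using h3.symm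

/-- The values of `∑ r ^ k / (k + 1)` on `[0, 1)` are unbounded. -/
theorem exists_lt_norm_logSeries (C : ℝ) :
    ∃ r : ℝ, 0 ≤ r ∧ r < 1 ∧ C < ‖logSeries r‖ := by
  by_contra! hcon
  have hsum {r : ℝ} (h0 : 0 ≤ r) (h1 : r < 1) : Summable fun k : ℕ => r ^ k / ((k : ℝ) + 1) := by
    refine .of_nonneg_of_le (fun _ => by positivity) (fun k => ?_)
      (summable_geometric_of_lt_one h0 h1)
    exact div_le_self (by positivity) (by linarith [(Nat.cast_nonneg k : (0 : ℝ) ≤ k)])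
  have hpart (N : ℕ) {r : ℝ} (h0 : 0 ≤ r) (h1 : r < 1) :
      ∑ k ∈ Finset.range N, r ^ k / ((k : ℝ) + 1) ≤ C := by
    refine le_trans ?_ (hcon r h0 h1)
    have e : logSeries r = ((∑' k : ℕ, r ^ k / ((k : ℝ) + 1) : ℝ) : ℂ) := by
      rw [logSeries, Complex.ofReal_tsum]
      push_cast
      rfl
    rw [e, Complex.norm_real]
    exact ((hsum h0 h1).sum_le_tsum _ fun _ _ => by positivity).trans (le_abs_self _)
  -- Letting `r → 1` with `N` fixed turns a bound on `f` into a bound on the harmonic sums.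
  have hlim (N : ℕ) : ∑ k ∈ Finset.range N, 1 / ((k : ℝ) + 1) ≤ C := by
    have hc : Continuous fun r : ℝ => ∑ k ∈ Finset.range N, r ^ k / ((k : ℝ) + 1) := by fun_prop
    have ht : Tendsto (fun r : ℝ => ∑ k ∈ Finset.range N, r ^ k / ((k : ℝ) + 1)) (𝓝[<] 1)
        (𝓝 (∑ k ∈ Finset.range N, 1 / ((k : ℝ) + 1))) := by
      simpa using (hc.tendsto 1).mono_left nhdsWithin_le_nhds
    refine le_of_tendsto ht ?_
    filter_upwards [Ico_mem_nhdsLT (zero_lt_one (α := ℝ))] with r hr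
    exact hpart N hr.1 hr.2
  obtain ⟨N, hN⟩ := (Real.tendsto_sum_range_one_div_nat_succ_atTop.eventually_gt_atTop C).exists
  exact absurd (hlim N) (not_le.2 hN)

end Reciprocal

/-! ### Isometries with orthogonal ranges: convergence, factorization, non-invertibility -/

section Isometries

variable {H : Type*} [NormedAddCommGroup H] [InnerProductSpace ℂ H]

theorem inner_map_map_of_isometry {T : H →L[ℂ] H} (hT : Isometry T) (x y : H) :
    inner ℂ (T x) (T y) = inner ℂ x y :=
  (⟨T.toLinearMap, fun x => hT.norm_map_of_map_zero (map_zero T) x⟩ : H →ₗᵢ[ℂ] H).inner_map_map x y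

theorem isometry_pow {T : H →L[ℂ] H} (hT : Isometry T) (k : ℕ) : Isometry ⇑(T ^ k) := by
  induction k with
  | zero => exact isometry_id
  | succ k ih =>
    rw [pow_succ]
    exact ih.comp hT

/-- The operator `X ^ k * L` for isometries `X` and `L`, as a linear isometry. -/
def powMulIsometry {L X : H →L[ℂ] H} (hL : Isometry L) (hX : Isometry X) (k : ℕ) :
    H →ₗᵢ[ℂ] H :=
  ⟨(X ^ k * L).toLinearMap, fun x =>
    ((isometry_pow hX k).comp hL).norm_map_of_map_zero (map_zero (X ^ k * L)) x⟩

theorem powMulIsometry_apply {L X : H →L[ℂ] H} (hL : Isometry L) (hX : Isometry X) (k : ℕ)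
    (x : H) : powMulIsometry hL hX k x = (X ^ k * L) x := rfl

variable {L X : H →L[ℂ] H}

theorem inner_range_eq_zero (hLX : X.range ≤ L.rangeᗮ) (x y : H) :
    inner ℂ (L x) (X y) = 0 :=
  (Submodule.mem_orthogonal _ _).1 (hLX (LinearMap.mem_range_self _ y)) _
    (LinearMap.mem_range_self _ x)

/-- Cancelling the isometry `X ^ j` leaves a vector of the range of `L` against one of the range of
`X`. -/
theorem inner_pow_add_mul_eq_zero (hX : Isometry X) (hLX : X.range ≤ L.rangeᗮ) (j m : ℕ)
    (x y : H) : inner ℂ ((X ^ j * L) x) ((X ^ (j + m + 1) * L) y) = 0 := by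
  have h : (X ^ (j + m + 1) * L) y = (X ^ j) (X ((X ^ m) (L y))) := by
    rw [add_assoc, pow_add, pow_succ' X m]
    rfl
  rw [h, mul_apply_eq_comp, inner_map_map_of_isometry (isometry_pow hX j),
    inner_range_eq_zero hLX]

theorem orthogonalFamily_powMulIsometry (hL : Isometry L) (hX : Isometry X)
    (hLX : X.range ≤ L.rangeᗮ) :
    OrthogonalFamily ℂ (fun _ : ℕ => H) (powMulIsometry hL hX) := by
  intro j k hjk x y
  simp only [powMulIsometry_apply]
  rcases lt_or_gt_of_ne hjk with h | h
  · obtain ⟨m, rfl⟩ := Nat.exists_eq_add_of_lt h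
    exact inner_pow_add_mul_eq_zero hX hLX j m x y
  · obtain ⟨m, rfl⟩ := Nat.exists_eq_add_of_lt h
    rw [inner_eq_zero_symm]
    exact inner_pow_add_mul_eq_zero hX hLX k m y x

/-- Pythagoras for orthogonal ranges: square-summable coefficients suffice for convergence in
operator norm. -/
theorem norm_sum_smul_pow_mul_le (hL : Isometry L) (hX : Isometry X)
    (hLX : X.range ≤ L.rangeᗮ) (b : ℕ → ℂ) (s : Finset ℕ) :
    ‖∑ k ∈ s, b k • (X ^ k * L)‖ ≤ √(∑ k ∈ s, ‖b k‖ ^ 2) := by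
  refine ContinuousLinearMap.opNorm_le_bound _ (Real.sqrt_nonneg _) fun x => ?_
  have h := (orthogonalFamily_powMulIsometry hL hX hLX).norm_sum (fun k => b k • x) s
  have e : (∑ k ∈ s, b k • (X ^ k * L)) x = ∑ k ∈ s, powMulIsometry hL hX k (b k • x) := by
    simp [powMulIsometry_apply]
  rw [← e] at h
  simp only [norm_smul, mul_pow, ← Finset.sum_mul] at h
  rw [← Real.sqrt_sq (norm_nonneg ((∑ k ∈ s, b k • (X ^ k * L)) x)), h,
    Real.sqrt_mul (Finset.sum_nonneg fun _ _ => by positivity), Real.sqrt_sq (norm_nonneg x)]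

theorem summable_smul_pow_mul [CompleteSpace H] (hL : Isometry L) (hX : Isometry X)
    (hLX : X.range ≤ L.rangeᗮ) {b : ℕ → ℂ} (hb : Summable fun k => ‖b k‖ ^ 2) :
    Summable fun k => b k • (X ^ k * L) := by
  rw [summable_iff_vanishing_norm]
  intro ε hε
  obtain ⟨s, hs⟩ := summable_iff_vanishing_norm.1 hb (ε ^ 2) (by positivity)
  refine ⟨s, fun t ht => (norm_sum_smul_pow_mul_le hL hX hLX b t).trans_lt ?_⟩
  rw [Real.sqrt_lt' hε]
  exact (le_abs_self _).trans_lt (hs t ht)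

theorem norm_le_of_hasSum_smul_pow_mul (hL : Isometry L) (hX : Isometry X)
    (hLX : X.range ≤ L.rangeᗮ) {b : ℕ → ℂ} (hb : Summable fun k => ‖b k‖ ^ 2) {T : H →L[ℂ] H}
    (hT : HasSum (fun k => b k • (X ^ k * L)) T) : ‖T‖ ≤ √(∑' k, ‖b k‖ ^ 2) :=
  le_of_tendsto hT.norm <| .of_forall fun s =>
    (norm_sum_smul_pow_mul_le hL hX hLX b s).trans <|
      Real.sqrt_le_sqrt (hb.sum_le_tsum s fun _ _ => by positivity)

theorem norm_le_one_of_isometry (hX : Isometry X) : ‖X‖ ≤ 1 :=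
  ContinuousLinearMap.opNorm_le_bound _ zero_le_one fun x => by
    rw [hX.norm_map_of_map_zero (map_zero X), one_mul]

theorem summable_norm_sq_one_div_natCast_add_one :
    Summable fun k : ℕ => ‖(1 / ((k : ℂ) + 1) : ℂ)‖ ^ 2 := by
  have h := (summable_nat_add_iff 1).2 (Real.summable_one_div_nat_pow.2 one_lt_two)
  refine h.congr fun k => ?_
  rw [norm_div, norm_one, ← Nat.cast_add_one, Complex.norm_natCast, div_pow, one_pow]

/-- Abel summation of `∑ X ^ k L / (k + 1)` in operator norm. -/
theorem tendsto_abel_of_hasSum [CompleteSpace H] (hL : Isometry L) (hX : Isometry X)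
    (hLX : X.range ≤ L.rangeᗮ) {A : H →L[ℂ] H}
    (hA : HasSum (fun k : ℕ => (1 / ((k : ℂ) + 1)) • (X ^ k * L)) A) :
    Tendsto (fun r : ℝ => ∑' k : ℕ, ((1 / ((k : ℂ) + 1)) * (r : ℂ) ^ k) • (X ^ k * L))
      (𝓝[<] 1) (𝓝 A) := by
  have hev : ∀ᶠ r : ℝ in 𝓝[<] 1, r ∈ Set.Ico (0 : ℝ) 1 := Ico_mem_nhdsLT zero_lt_one
  have hle {r : ℝ} (hr : r ∈ Set.Ico (0 : ℝ) 1) (k : ℕ) : ‖(1 - (r : ℂ) ^ k)‖ ≤ 1 := by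
    rw [← Complex.ofReal_pow, ← Complex.ofReal_one, ← Complex.ofReal_sub, Complex.norm_real,
      Real.norm_eq_abs, abs_le]
    constructor <;> linarith [pow_nonneg hr.1 k, pow_le_one₀ hr.1 hr.2.le (n := k)]
  have hpow {r : ℝ} (hr : r ∈ Set.Ico (0 : ℝ) 1) (k : ℕ) : ‖((r : ℂ) ^ k)‖ ≤ 1 := by
    rw [← Complex.ofReal_pow, Complex.norm_real, Real.norm_eq_abs, abs_of_nonneg (pow_nonneg hr.1 k)]
    exact pow_le_one₀ hr.1 hr.2.le
  have hmul (k : ℕ) {w : ℂ} (hw : ‖w‖ ≤ 1) :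
      ‖(1 / ((k : ℂ) + 1)) * w‖ ^ 2 ≤ ‖(1 / ((k : ℂ) + 1) : ℂ)‖ ^ 2 := by
    rw [norm_mul]
    gcongr
    exact mul_le_of_le_one_right (norm_nonneg _) hw
  have hs := summable_norm_sq_one_div_natCast_add_one
  -- The `ℓ²` norm of `(1 - r^k)/(k+1)` bounds the distance from `A` to its Abel mean; it vanishes
  -- in the limit by dominated convergence.
  have hT : Tendsto (fun r : ℝ => √(∑' k : ℕ, ‖(1 / ((k : ℂ) + 1)) * (1 - (r : ℂ) ^ k)‖ ^ 2))
      (𝓝[<] 1) (𝓝 0) := by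
    have h0 : Tendsto (fun r : ℝ => ∑' k : ℕ, ‖(1 / ((k : ℂ) + 1)) * (1 - (r : ℂ) ^ k)‖ ^ 2)
        (𝓝[<] 1) (𝓝 (∑' _ : ℕ, 0)) := by
      refine tendsto_tsum_of_dominated_convergence hs (fun k => ?_) ?_
      · have hc : Continuous fun r : ℝ => ‖(1 / ((k : ℂ) + 1)) * (1 - (r : ℂ) ^ k)‖ ^ 2 := by
          fun_prop
        simpa using (hc.tendsto 1).mono_left nhdsWithin_le_nhds
      · filter_upwards [hev] with r hr k
        rw [Real.norm_of_nonneg (by positivity)]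
        exact hmul k (hle hr k)
    simpa using h0.sqrt
  rw [tendsto_iff_norm_sub_tendsto_zero]
  refine squeeze_zero' (.of_forall fun _ => norm_nonneg _) ?_ hT
  filter_upwards [hev] with r hr
  have h1 := (summable_smul_pow_mul hL hX hLX (b := fun k => (1 / ((k : ℂ) + 1)) * (r : ℂ) ^ k)
    (.of_nonneg_of_le (fun _ => by positivity) (fun k => hmul k (hpow hr k)) hs)).hasSum
  have h2 := hA.sub h1
  rw [norm_sub_rev]
  refine norm_le_of_hasSum_smul_pow_mul hL hX hLX
    (.of_nonneg_of_le (fun _ => by positivity) (fun k => hmul k (hle hr k)) hs) ?_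
  refine h2.congr_fun fun k => ?_
  rw [← sub_smul, mul_sub, mul_one]

theorem tendsto_abel_recipCoeff [Nontrivial H] [CompleteSpace H] (hX : ‖X‖ ≤ 1) :
    Tendsto (fun r : ℝ => ∑' k : ℕ, ((recipCoeff k : ℂ) * (r : ℂ) ^ k) • X ^ k)
      (𝓝[<] 1) (𝓝 (∑' k : ℕ, (recipCoeff k : ℂ) • X ^ k)) := by
  refine tendsto_tsum_of_dominated_convergence summable_abs_recipCoeff (fun k => ?_) ?_
  · have hc : Continuous fun r : ℝ => ((recipCoeff k : ℂ) * (r : ℂ) ^ k) • X ^ k := by fun_prop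
    simpa using (hc.tendsto 1).mono_left nhdsWithin_le_nhds
  · filter_upwards [Ico_mem_nhdsLT (zero_lt_one (α := ℝ))] with r hr k
    have h := norm_recipCoeff_smul_pow_le ((r : ℂ) • X) ?_ k
    · rwa [smul_pow, smul_smul] at h
    · rw [norm_smul, Complex.norm_real, Real.norm_of_nonneg hr.1]
      exact mul_le_one₀ hr.2.le (norm_nonneg _) hX

/-- The identity holds at each radius `r < 1`, where `f(rX)` converges absolutely, and passes to the
limit because both Abel means converge in norm. -/
theorem tsum_recipCoeff_mul_of_hasSum [Nontrivial H] [CompleteSpace H] (hL : Isometry L)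
    (hX : Isometry X) (hLX : X.range ≤ L.rangeᗮ) {A : H →L[ℂ] H}
    (hA : HasSum (fun k : ℕ => (1 / ((k : ℂ) + 1)) • (X ^ k * L)) A) :
    (∑' k : ℕ, (recipCoeff k : ℂ) • X ^ k) * A = L := by
  have hX1 := norm_le_one_of_isometry hX
  have h := (tendsto_abel_recipCoeff hX1).mul (tendsto_abel_of_hasSum hL hX hLX hA)
  refine tendsto_nhds_unique (h.congr' ?_) tendsto_const_nhds
  filter_upwards [Ico_mem_nhdsLT (zero_lt_one (α := ℝ))] with r hr
  have hr1 : ‖(r : ℂ) • X‖ < 1 := by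
    rw [norm_smul, Complex.norm_real, Real.norm_of_nonneg hr.1]
    exact (mul_le_of_le_one_right hr.1 hX1).trans_lt hr.2
  have h1 := tsum_recipCoeff_mul_tsum_logSeries _ hr1
  have h2 := (summable_norm_logSeries_smul_pow _ hr1).of_norm.tsum_mul_right L
  simp only [smul_pow, smul_smul, smul_mul_assoc] at h1 h2
  rw [h2, ← mul_assoc, h1, one_mul]

/-- If `A x = L u`, pairing with `X L x` kills the right side and every term of the series but `k =
1`. What remains is `‖x‖²/2 = 0`, so `L u = 0`. -/
theorem not_isUnit_of_hasSum [Nontrivial H] (hL : Isometry L) (hX : Isometry X)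
    (hLX : X.range ≤ L.rangeᗮ) {A : H →L[ℂ] H}
    (hA : HasSum (fun k : ℕ => (1 / ((k : ℂ) + 1)) • (X ^ k * L)) A) : ¬ IsUnit A := by
  rintro ⟨U, rfl⟩
  obtain ⟨u, hu⟩ := exists_ne (0 : H)
  set x := (↑U⁻¹ : H →L[ℂ] H) (L u) with hx
  have hUx : (U : H →L[ℂ] H) x = L u := by
    rw [hx, ← mul_apply_eq_comp, U.mul_inv, one_apply_eq_self]
  have h1 : HasSum (fun k : ℕ => inner ℂ (X (L x)) (((1 / ((k : ℂ) + 1)) • (X ^ k * L)) x))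
      (inner ℂ (X (L x)) ((U : H →L[ℂ] H) x)) :=
    (hA.mapL (ContinuousLinearMap.apply ℂ H x)).mapL (innerSL ℂ (X (L x)))
  have hO := orthogonalFamily_powMulIsometry hL hX hLX
  have h2 : HasSum (fun k : ℕ => inner ℂ (X (L x)) (((1 / ((k : ℂ) + 1)) • (X ^ k * L)) x))
      (inner ℂ (X (L x)) (((1 / (((1 : ℕ) : ℂ) + 1)) • (X ^ 1 * L)) x)) := by
    refine hasSum_single 1 fun k hk => ?_
    have h3 := hO hk.symm x x
    simp only [powMulIsometry_apply, pow_one, mul_apply_eq_comp] at h3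
    rw [smul_apply, inner_smul_right, mul_apply_eq_comp, h3,
      mul_zero]
  have h4 := h1.unique h2
  rw [hUx, inner_eq_zero_symm.1 (inner_range_eq_zero hLX u (L x)), pow_one,
    smul_apply, inner_smul_right, mul_apply_eq_comp,
    inner_map_map_of_isometry hX, inner_map_map_of_isometry hL] at h4
  have hx0 : x = 0 := by
    rcases mul_eq_zero.1 h4.symm with h | h
    · norm_num at h
    · exact inner_self_eq_zero.1 h
  rw [hx0, map_zero] at hUx
  exact hu (hL.injective (by rw [← hUx, map_zero]))

theorem not_isUnit_tsum_recipCoeff [Nontrivial H] [CompleteSpace H] (hL : Isometry L)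
    (hX : Isometry X) (hLX : X.range ≤ L.rangeᗮ) :
    ¬ IsUnit (∑' k : ℕ, (recipCoeff k : ℂ) • X ^ k) := by
  rintro ⟨U, hU⟩
  have hX1 := norm_le_one_of_isometry hX
  obtain ⟨u, hu⟩ := exists_ne (0 : H)
  -- This `r` makes `1/|g(r)|` exceed the norm of the supposed inverse of `g(X)`.
  obtain ⟨r, hr0, hr1, hr⟩ := exists_lt_norm_logSeries ‖(↑U⁻¹ : H →L[ℂ] H)‖
  have hrX : ‖(r : ℂ) • X‖ < 1 := by
    rw [norm_smul, Complex.norm_real, Real.norm_of_nonneg hr0]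
    exact (mul_le_of_le_one_right hr0 hX1).trans_lt hr1
  obtain ⟨v, hv⟩ : ∃ v : H, v = L u + (r : ℂ) • X v := by
    refine ⟨(↑(Units.oneSub _ hrX)⁻¹ : H →L[ℂ] H) (L u), ?_⟩
    have h := congrArg (fun T : H →L[ℂ] H => T (L u)) (Units.oneSub _ hrX).mul_inv
    simp only [Units.val_oneSub, mul_apply_eq_comp, sub_apply,
      one_apply_eq_self, smul_apply] at h
    exact (sub_eq_iff_eq_add.1 h)
  have hv0 : v ≠ 0 := by
    rintro rfl
    rw [map_zero, smul_zero, add_zero] at hv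
    exact hu (hL.injective (by rw [← hv, map_zero]))
  -- As `L u` is orthogonal to the range of `X`, the vector `v = (1 - rX)⁻¹ L u` satisfies `X* v = r
  -- v`.
  have hshift (y : H) : inner ℂ v (X y) = r * inner ℂ v y := by
    conv_lhs => rw [hv]
    rw [inner_add_left, inner_range_eq_zero hLX, inner_smul_left, inner_map_map_of_isometry hX,
      Complex.conj_ofReal, zero_add]
  have hpow (k : ℕ) (y : H) : inner ℂ v ((X ^ k) y) = (r : ℂ) ^ k * inner ℂ v y := by
    induction k with
    | zero => simp
    | succ k ih => rw [pow_succ', mul_apply_eq_comp, hshift, ih, pow_succ', mul_assoc]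
  have hG (y : H) : inner ℂ v ((U : H →L[ℂ] H) y) =
      (∑' k : ℕ, (recipCoeff k : ℂ) • (r : ℂ) ^ k) * inner ℂ v y := by
    have h1 := (summable_norm_recipCoeff_smul_pow X hX1).of_norm.hasSum
    rw [← hU] at h1
    have h2 : HasSum (fun k : ℕ => inner ℂ v (((recipCoeff k : ℂ) • X ^ k) y))
        (inner ℂ v ((U : H →L[ℂ] H) y)) :=
      (h1.mapL (ContinuousLinearMap.apply ℂ H y)).mapL (innerSL ℂ v)
    rw [← h2.tsum_eq, ← tsum_mul_right]
    refine tsum_congr fun k => ?_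
    rw [smul_apply, inner_smul_right, hpow, smul_eq_mul, mul_assoc]
  have hrb : (r : ℂ) ∈ ball (0 : ℂ) 1 := by
    rw [mem_ball_zero_iff, Complex.norm_real, Real.norm_of_nonneg hr0]
    exact hr1
  have h3 := hG ((↑U⁻¹ : H →L[ℂ] H) v)
  rw [← mul_apply_eq_comp, U.mul_inv, one_apply_eq_self] at h3
  have h4 : logSeries r * inner ℂ v v = inner ℂ v ((↑U⁻¹ : H →L[ℂ] H) v) := by
    rw [h3, ← mul_assoc, mul_comm (logSeries _), tsum_recipCoeff_mul_logSeries hrb, one_mul]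
  have h5 : ‖logSeries r‖ * ‖v‖ ^ 2 ≤ ‖(↑U⁻¹ : H →L[ℂ] H)‖ * ‖v‖ ^ 2 := by
    calc ‖logSeries r‖ * ‖v‖ ^ 2 = ‖logSeries r * inner ℂ v v‖ := by
          rw [norm_mul, inner_self_eq_norm_sq_to_K]; simp
      _ ≤ ‖v‖ * ‖(↑U⁻¹ : H →L[ℂ] H) v‖ := by rw [h4]; exact norm_inner_le_norm _ _
      _ ≤ ‖v‖ * (‖(↑U⁻¹ : H →L[ℂ] H)‖ * ‖v‖) := by
          gcongr; exact ContinuousLinearMap.le_opNorm _ _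
      _ = _ := by ring
  exact absurd (le_of_mul_le_mul_right h5 (by positivity)) (not_le.2 hr)

end Isometries

/-! ### Membership in the Toeplitz algebra and the generators -/

section Toeplitz

variable {ι : Type*}

instance nontrivial_fock : Nontrivial (Fock ι) :=
  ⟨xi 1, 0, orthonormal_xi.ne_zero 1⟩

/-- The norm topology is finer than the weak operator topology, so norm limits of polynomials in `X`
and `L` stay in the algebra. -/
theorem isClosed_toeplitzAlgebra :
    IsClosed (toeplitzAlgebra ι : Set (Fock ι →L[ℂ] Fock ι)) :=
  isClosed_closure.preimage ContinuousLinearMapWOT.continuous_ofCLM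

theorem lam_of_mem_toeplitzAlgebra (i : ι) : lam (FreeMonoid.of i) ∈ toeplitzAlgebra ι :=
  (mem_toeplitzAlgebra_iff _).2 <|
    subset_closure ⟨_, Algebra.subset_adjoin ⟨i, rfl⟩, rfl⟩

theorem isometry_lam (w : FreeMonoid ι) : Isometry (lam w) :=
  (orthonormal_xi_mul w).orthogonalFamily.linearIsometry.isometry

theorem hasSum_lam (w : FreeMonoid ι) (x : Fock ι) :
    HasSum (fun v => x v • xi (w * v)) (lam w x) :=
  (orthonormal_xi_mul w).orthogonalFamily.hasSum_linearIsometry x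

/-- Words with different first letters are distinct, so the basis vectors spanning the two ranges
are orthogonal. -/
theorem range_lam_le_orthogonal {i j : ι} (hij : i ≠ j) :
    (lam (FreeMonoid.of j)).range ≤ (lam (FreeMonoid.of i)).rangeᗮ := by
  rintro _ ⟨y, rfl⟩
  rw [Submodule.mem_orthogonal]
  rintro _ ⟨x, rfl⟩
  have h0 (v : FreeMonoid ι) (y : Fock ι) :
      inner ℂ (xi (FreeMonoid.of i * v)) (lam (FreeMonoid.of j) y) = 0 := by
    refine ((hasSum_lam (FreeMonoid.of j) y).mapL (innerSL ℂ _)).unique ?_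
    convert hasSum_zero using 2 with w
    have hne : FreeMonoid.of i * v ≠ FreeMonoid.of j * w := fun h =>
      hij (List.cons.inj (congrArg FreeMonoid.toList h)).1
    rw [innerSL_apply_apply, inner_smul_right, orthonormal_xi.2 hne, mul_zero]
  rw [inner_eq_zero_symm]
  refine ((hasSum_lam (FreeMonoid.of i) x).mapL (innerSL ℂ _)).unique ?_
  convert hasSum_zero using 2 with v
  rw [innerSL_apply_apply, inner_smul_right]
  exact mul_eq_zero_of_right _ (inner_eq_zero_symm.1 (h0 v y))

theorem exists_isProperFactorization {L X : Fock ι →L[ℂ] Fock ι}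
    (hLm : L ∈ toeplitzAlgebra ι) (hXm : X ∈ toeplitzAlgebra ι)
    (hL : Isometry L) (hX : Isometry X) (hLX : X.range ≤ L.rangeᗮ) :
    ∃ A G : Fock ι →L[ℂ] Fock ι,
      HasSum (fun k : ℕ => (1 / ((k : ℂ) + 1)) • (X ^ k * L)) A ∧
      IsHInftyCalculus X (fun z => 1 / logSeries z) G ∧ IsProperFactorization L G A := by
  have hX1 := norm_le_one_of_isometry hX
  have hA := (summable_smul_pow_mul hL hX hLX summable_norm_sq_one_div_natCast_add_one).hasSum
  refine ⟨_, ∑' k : ℕ, (recipCoeff k : ℂ) • X ^ k, hA, fun x => ?_, ?_, ?_,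
    (tsum_recipCoeff_mul_of_hasSum hL hX hLX hA).symm,
    not_isUnit_tsum_recipCoeff hL hX hLX, not_isUnit_of_hasSum hL hX hLX hA⟩
  · simp only [taylorCoeff_one_div_logSeries]
    exact ((ContinuousLinearMap.apply ℂ (Fock ι) x).continuous.tendsto _).comp
      (tendsto_abel_recipCoeff hX1)
  · exact isClosed_toeplitzAlgebra.mem_of_tendsto
      (summable_norm_recipCoeff_smul_pow X hX1).of_norm.hasSum <| .of_forall fun s =>
        sum_mem fun k _ => Subalgebra.smul_mem _ (pow_mem hXm k) _
  · exact isClosed_toeplitzAlgebra.mem_of_tendsto hA <| .of_forall fun s =>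
      sum_mem fun k _ => Subalgebra.smul_mem _ (mul_mem (pow_mem hXm k) hLm) _

end Toeplitz

end NCToeplitz

end

theorem theorem2p6 {ι : Type*} [Nonempty ι] [Countable ι] :
    ((∀ z ∈ Metric.ball (0 : ℂ) 1, NCToeplitz.logSeries z ≠ 0) ∧
      NCToeplitz.IsHInfty (fun z => 1 / NCToeplitz.logSeries z)) ∧
    (∀ L X : NCToeplitz.Fock ι →L[ℂ] NCToeplitz.Fock ι,
      L ∈ NCToeplitz.toeplitzAlgebra ι → X ∈ NCToeplitz.toeplitzAlgebra ι →
      Isometry L → Isometry X → X.range ≤ L.rangeᗮ →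
      ∃ A G : NCToeplitz.Fock ι →L[ℂ] NCToeplitz.Fock ι,
        HasSum (fun k : ℕ => (1 / ((k : ℂ) + 1)) • (X ^ k * L)) A ∧
        NCToeplitz.IsHInftyCalculus X (fun z => 1 / NCToeplitz.logSeries z) G ∧
        NCToeplitz.IsProperFactorization L G A) ∧
    (Nontrivial ι → ∀ i : ι, ∃ B C : NCToeplitz.Fock ι →L[ℂ] NCToeplitz.Fock ι,
      NCToeplitz.IsProperFactorization (NCToeplitz.lam (FreeMonoid.of i)) B C) := by
  exact ⟨⟨fun _ => NCToeplitz.logSeries_ne_zero, NCToeplitz.isHInfty_one_div_logSeries⟩,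
    fun _ _ hLm hXm hL hX hLX => NCToeplitz.exists_isProperFactorization hLm hXm hL hX hLX,
    fun _ i => by
      obtain ⟨j, hj⟩ := exists_ne i
      obtain ⟨A, G, -, -, h⟩ := NCToeplitz.exists_isProperFactorization
        (NCToeplitz.lam_of_mem_toeplitzAlgebra i) (NCToeplitz.lam_of_mem_toeplitzAlgebra j)
        (NCToeplitz.isometry_lam _) (NCToeplitz.isometry_lam _)
        (NCToeplitz.range_lam_le_orthogonal hj.symm)
      exact ⟨G, A, h⟩⟩
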